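/- Let $G=(V,E)$ be a complete undirected graph on a finite vertex set with metric edge lengths $c_e\ge 0$ and a root $r\in V$. For $S\subseteq V$ let $\delta(S)$ be the set of edges with exactly one endpoint in $S$, and $\delta(v)=\delta(\{v\})$. A pair $(x,y)\in\mathbb R^E\times\mathbb R^V$ is called feasible if $x\ge 0$, $y\ge 0$, $y_r=1$, $x(\delta(r))\le 2$, $x(\delta(v))=2y_v$ for all $v\in V\setminus\{r\}$, and $x(\delta(S))\ge 2y_v$ for all $S\subseteq V\setminus\{r\}$ and $v\in S$ (the linear programming relaxation of prize-collecting TSP). Let $\delta\in[0,1)$, $\kappa\in[\delta,1]$, and let $(x^*,y^*)$ be feasible (for example, optimal for the relaxation). Let $(x,y)$ be obtained from $(x^*,y^*)$ by performing, one after another, complete splittings at all vertices $v$ with $y^*_v<\delta$. Here a feasible splitting at $v$ decreases $x_{\{v,s\}}$, $x_{\{v,t\}}$ and $y_v$ by some $\varepsilon\ge0$ and increases $x_{\{s,t\}}$ by $\varepsilon$ in such a way that the result is feasible (if $s=t$, then $x_{\{v,s\}}$ decreases by $2\varepsilon$ and the loop is discarded); a complete splitting at $v$ is a finite sequence of feasible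 splittings at $v$ that ends with $y_v=0$. Let $\mathcal T$ be a finite set of trees in $G$, all containing $r$, with weights $\mu\in[0,1]^{\mathcal T}$ such that $\sum_{T\in\mathcal T}\mu_T=1$, $\sum_{T\in\mathcal T}\mu_T\chi^{E[T]}\le x$, and $\sum_{T\in\mathcal T:\,v\in V[T]}\mu_T=y_v$ for all $v\in V$. Let $T_0\in\mathcal T$ be random with $\mathbb P[T_0=T]=\mu_T$ for every $T\in\mathcal T$, and let $\gamma\in[\delta,\kappa]$ be random, independent of $T_0$, with $$\mathbb P[\gamma\le t]=\frac{3-\delta-\kappa}{3-\delta-t}\qquad\text{for all } t\in[\delta,\kappa].$$ Let $T=\operatorname{core}(T_0,\gamma)$ be the inclusion-wise minimal subtree of $T_0$ that spans all vertices $v\in V[T_0]$ with $y_v\ge\gamma$. Let $C$ be a (random) cycle obtained from $T$ by adding a shortest $\operatorname{odd}(T)$-join, i.e. a minimum-length edge set having odd degree exactly at the vertices of odd degree in $T$, and shortcutting an Eulerian walk in the resulting multigraph. (A cycle on two vertices $u,v$ has length $2c_{\{u,v\}}$, and a cycle on one vertex has length $0$.) Then $$\mathbb E\big[c(E[C])\big]\le\frac{7-2\delta-2\kappa}{3-\delta}\cdot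 c^\top x^*.$$ -/

import Mathlib

namespace PCTSP

open Finset

/-- Edge set of the complete graph on `V` (no loops). -/
def edges (V : Type*) [Fintype V] [DecidableEq V] : Finset (Sym2 V) :=
  univ.filter fun e => ¬ e.IsDiag

/-- Metric edge lengths: nonnegative, symmetric (they are indexed by unordered pairs) and satisfying
the triangle inequality; the distance of a vertex to itself is zero. -/
structure IsMetric {V : Type*} (c : Sym2 V → ℝ) : Prop where
  self : ∀ v, c s(v, v) = 0
  nonneg : ∀ e, 0 ≤ c e
  triangle : ∀ u v w, c s(u, w) ≤ c s(u, v) + c s(v, w)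

/-- `cᵀ x`. Only the values on `edges V` matter. -/
def cost {V : Type*} [Fintype V] [DecidableEq V] (c x : Sym2 V → ℝ) : ℝ :=
  ∑ e ∈ edges V, c e * x e

open Classical in
/-- `δ(S)`: the edges with exactly one endpoint in `S`. -/
noncomputable def cut {V : Type*} [Fintype V] [DecidableEq V] (S : Finset V) : Finset (Sym2 V) :=
  (edges V).filter fun e => ∃ u v, e = s(u, v) ∧ u ∈ S ∧ v ∉ S

/-- Feasibility of `(x, y)` for the linear programming relaxation of prize-collecting TSP
with root `r`. -/
structure Feasible {V : Type*} [Fintype V] [DecidableEq V] (r : V)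
    (x : Sym2 V → ℝ) (y : V → ℝ) : Prop where
  degree : ∀ v, v ≠ r → ∑ e ∈ cut {v}, x e = 2 * y v
  degree_root : ∑ e ∈ cut {r}, x e ≤ 2
  cuts : ∀ S : Finset V, r ∉ S → ∀ v ∈ S, 2 * y v ≤ ∑ e ∈ cut S, x e
  root : y r = 1
  nonneg_x : ∀ e ∈ edges V, 0 ≤ x e
  nonneg_y : ∀ v, 0 ≤ y v

/-- A feasible splitting at `v`: for some `ε ≥ 0`, the weight of the edges `{v,s}` and `{v,t}` is
decreased by `ε`, the weight of `{s,t}` is increased by `ε`, the value at `v` is decreased by `ε`,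
and the result is feasible. In the case `s = t` the new edge is a loop, which is discarded (values on
loops are never used); feasibility then only permits `s = t = r` or `ε = 0`. -/
def FeasibleSplitting {V : Type*} [Fintype V] [DecidableEq V] (r v : V)
    (p q : (Sym2 V → ℝ) × (V → ℝ)) : Prop :=
  ∃ (s t : V) (ε : ℝ), s ≠ v ∧ t ≠ v ∧ 0 ≤ ε ∧
    q.1 = p.1 - Pi.single s(v, s) ε - Pi.single s(v, t) ε + Pi.single s(s, t) ε ∧
    q.2 = p.2 - Pi.single v ε ∧
    Feasible r q.1 q.2

/-- A complete splitting at `v`: a sequence of feasible splittings at `v` that results in `y v = 0`. -/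
def CompleteSplitting {V : Type*} [Fintype V] [DecidableEq V] (r v : V)
    (p q : (Sym2 V → ℝ) × (V → ℝ)) : Prop :=
  Relation.ReflTransGen (FeasibleSplitting r v) p q ∧ q.2 v = 0

/-- Complete splittings performed one after another at the vertices of a list. -/
inductive CompleteSplittings {V : Type*} [Fintype V] [DecidableEq V] (r : V) :
    List V → (Sym2 V → ℝ) × (V → ℝ) → (Sym2 V → ℝ) × (V → ℝ) → Prop
  | nil (p) : CompleteSplittings r [] p p
  | cons {v l p q q'} : CompleteSplitting r v p q → CompleteSplittings r l q q' →
      CompleteSplittings r (v :: l) p q'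

/-- `(x, y)` arises from `(x', y')` by complete splittings, in some order, at all vertices whose
value is smaller than `δ`. -/
def ObtainedBySplitting {V : Type*} [Fintype V] [DecidableEq V] (r : V) (δ : ℝ)
    (x' : Sym2 V → ℝ) (y' : V → ℝ) (x : Sym2 V → ℝ) (y : V → ℝ) : Prop :=
  ∃ l : List V, l.Nodup ∧ (∀ v, v ∈ l ↔ y' v < δ) ∧ CompleteSplittings r l (x', y') (x, y)

/-- Subgraphs of the complete graph on `V`. -/
abbrev Subgr (V : Type*) := (⊤ : SimpleGraph V).Subgraph

/-- Subgraph-valued random variables are discrete. -/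
instance instMeasurableSpaceSubgr (V : Type*) : MeasurableSpace (Subgr V) := ⊤

open Classical in
/-- `(𝒯, μ)` is a decomposition of `(x, y)` into trees containing the root `r`. -/
structure IsTreeDecomposition {V : Type*} [Fintype V] [DecidableEq V] (r : V)
    (x : Sym2 V → ℝ) (y : V → ℝ) (𝒯 : Finset (Subgr V)) (μ : Subgr V → ℝ) : Prop where
  isTree : ∀ T ∈ 𝒯, T.coe.IsTree
  root_mem : ∀ T ∈ 𝒯, r ∈ T.verts
  mem_Icc : ∀ T ∈ 𝒯, μ T ∈ Set.Icc (0 : ℝ) 1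
  sum_eq_one : ∑ T ∈ 𝒯, μ T = 1
  edge_le : ∀ e ∈ edges V, ∑ T ∈ 𝒯 with e ∈ T.edgeSet, μ T ≤ x e
  vert_eq : ∀ v, ∑ T ∈ 𝒯 with v ∈ T.verts, μ T = y v

/-- `T' = core(T, γ)` with respect to `y`: `T'` is the inclusion-wise minimal subtree of `T` that
spans all vertices `v` of `T` with `y v ≥ γ`. -/
def IsCore {V : Type*} (y : V → ℝ) (T : Subgr V) (γ : ℝ) (T' : Subgr V) : Prop :=
  Minimal (fun H : Subgr V => H ≤ T ∧ H.coe.IsTree ∧ ∀ v ∈ T.verts, γ ≤ y v → v ∈ H.verts) T'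

open Classical in
/-- The edges of a subgraph, as a finite set. -/
noncomputable def subEdges {V : Type*} [Fintype V] [DecidableEq V] (T : Subgr V) :
    Finset (Sym2 V) :=
  univ.filter fun e => e ∈ T.edgeSet

/-- The vertices of odd degree with respect to a set of edges. -/
def oddVerts {V : Type*} [Fintype V] [DecidableEq V] (F : Finset (Sym2 V)) : Finset V :=
  univ.filter fun v => Odd (#{e ∈ F | v ∈ e})

/-- A `Q`-join: a set of edges that has odd degree precisely at the vertices in `Q`. -/
def IsJoin {V : Type*} [Fintype V] [DecidableEq V] (Q : Finset V) (J : Finset (Sym2 V)) : Prop :=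
  J ⊆ edges V ∧ oddVerts J = Q

/-- A shortest `Q`-join. -/
def IsShortestJoin {V : Type*} [Fintype V] [DecidableEq V] (c : Sym2 V → ℝ) (Q : Finset V)
    (J : Finset (Sym2 V)) : Prop :=
  IsJoin Q J ∧ ∀ J', IsJoin Q J' → ∑ e ∈ J, c e ≤ ∑ e ∈ J', c e

/-- Length of the cycle that visits the vertices of `C` in this order and returns to the first one.
For two vertices `u, v` this is `2 c(u, v)`; for one vertex it is `c(v, v) = 0`. -/
def cycleLength {V : Type*} (c : Sym2 V → ℝ) (C : List V) : ℝ :=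
  (List.zipWith (fun u v => c s(u, v)) C (C.rotate 1)).sum

/-- `C` is a cycle obtained from the tree `T` by parity correction and shortcutting: there are a
shortest `odd(T)`-join `J` and an Eulerian walk `w` of the multigraph `T + J` (a closed walk that uses
every edge exactly as often as it occurs in `T + J` and visits all vertices), and `C` arises from the
vertex sequence of `w` by keeping exactly one occurrence of each vertex. -/
def IsCorrectedCycle {V : Type*} [Fintype V] [DecidableEq V] (c : Sym2 V → ℝ) (T : Subgr V)
    (C : List V) : Prop :=
  ∃ (J : Finset (Sym2 V)) (u : V) (w : (⊤ : SimpleGraph V).Walk u u),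
    IsShortestJoin c (oddVerts (subEdges T)) J ∧
    (w.edges : Multiset (Sym2 V)) = (subEdges T).val + J.val ∧
    (∀ v ∈ T.verts, v ∈ w.support) ∧
    C.Sublist w.support ∧ C.Nodup ∧ ∀ v ∈ w.support, v ∈ C

end PCTSP

namespace PCTSP

open Finset MeasureTheory

open scoped symmDiff

/-! ### Parity calculus for joins and cuts. -/

section Joins

variable {V : Type*} [Fintype V] [DecidableEq V]

/-! Every edge `e` of a sampled tree `T₀` gets a peak: a vertex of largest value `t` on the side of
`e` away from the root. If `e` survives in the core `T`, then `γ ≤ t`, since otherwise the far side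
could be pruned (`IsCore.le_peak`).

Parity correction is paid fractionally by `x / (3 - δ)` plus `(3 - δ - 2t) / (3 - δ)` on each edge
of `T`. An odd cut crossed by `T` only in `e` separates the peak from `r` (`IsCore.peak_mem`), so
its `x`-weight is at least `2t` and the total is at least 1. An odd cut crossed at least three times
has `x`-weight at least `2δ`, while each crossing adds at least `(1 - δ) / (3 - δ)`; again the total
is at least 1. This gives `shortest_join_le_of_isCore`.

Apart from `cost c x / (3 - δ)`, an edge of `T` thus costs `2(3 - δ - t) / (3 - δ)` times its
length, and conditioned on `T₀` it survives with probability at most `(3 - δ - κ) / (3 - δ - t)` if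
`t ≤ κ`, and at most 1 otherwise. The law of `γ` is designed to cancel `t`: the product is at most
`2(3 - δ - κ) / (3 - δ)`. Summing gives the factor `(1 + 2(3 - δ - κ)) / (3 - δ)` on `cost c x`, and
splitting never increases the cost.

The deep ingredient is `IsShortestJoin.le_of_covers_cuts`: covering all `Q`-cuts fractionally costs
at least a shortest `Q`-join. For integral weights that are even on even edge sets, an integral
packing of `Q`-cuts is peeled off one cut at a time (`exists_cut_of_shortest_join`); real weights
follow by scaling and rounding. -/

lemma mk_mem_edges {u v : V} : s(u, v) ∈ edges V ↔ u ≠ v := by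
  simp [edges]

lemma mk_mem_cut {S : Finset V} {u v : V} : s(u, v) ∈ cut S ↔ ¬ (u ∈ S ↔ v ∈ S) := by
  simp only [cut, mem_filter, mk_mem_edges, Sym2.eq_iff]
  constructor
  · rintro ⟨-, a, b, h, ha, hb⟩
    rcases h with ⟨rfl, rfl⟩ | ⟨rfl, rfl⟩ <;> tauto
  · intro h
    refine ⟨by rintro rfl; exact h Iff.rfl, ?_⟩
    by_cases hu : u ∈ S
    · exact ⟨u, v, Or.inl ⟨rfl, rfl⟩, hu, by tauto⟩
    · exact ⟨v, u, Or.inr ⟨rfl, rfl⟩, by tauto, hu⟩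

lemma cut_subset_edges (S : Finset V) : cut S ⊆ edges V := by
  unfold cut; exact filter_subset _ _

lemma cut_compl (S : Finset V) : cut Sᶜ = cut S := by
  ext e
  induction e with | _ u v => simp only [mk_mem_cut, mem_compl]; tauto

lemma odd_card_symmDiff {α : Type*} [DecidableEq α] (A B : Finset α) :
    Odd #(A ∆ B) ↔ ¬ (Odd #A ↔ Odd #B) := by
  have h1 : #(A ∆ B) = #(A \ B) + #(B \ A) := by
    rw [symmDiff_def, sup_eq_union, card_union_of_disjoint disjoint_sdiff_sdiff]
  have h2 := card_sdiff_add_card_inter A B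
  have h3 := card_sdiff_add_card_inter B A
  rw [inter_comm B A] at h3
  simp only [Nat.odd_iff]
  omega

lemma symmDiff_symmDiff_left_cancel {α : Type*} [DecidableEq α] (A B C : Finset α) :
    (A ∆ B) ∆ (A ∆ C) = B ∆ C := by
  ext; simp only [mem_symmDiff]; tauto

lemma symmDiff_symmDiff_mid_cancel {α : Type*} [DecidableEq α] (A B C : Finset α) :
    (A ∆ B) ∆ (B ∆ C) = A ∆ C := by
  ext; simp only [mem_symmDiff]; tauto

lemma symmDiff_move_endpoint {α : Type*} [DecidableEq α] (Q X A B C : Finset α) :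
    ((Q ∆ (X ∆ A)) ∆ (B ∆ C)) ∆ (A ∆ B) = Q ∆ (X ∆ C) := by
  rw [symmDiff_assoc, symmDiff_comm (B ∆ C), symmDiff_symmDiff_mid_cancel, symmDiff_assoc,
    symmDiff_symmDiff_mid_cancel]

lemma sdiff_eq_symmDiff_of_subset {α : Type*} [DecidableEq α] {F P : Finset α} (h : P ⊆ F) :
    F \ P = F ∆ P := by
  rw [symmDiff_def, sdiff_eq_empty_iff_subset.2 h]; simp

lemma symmDiff_singleton_eq_insert {α : Type*} [DecidableEq α] {P : Finset α} {e : α} (h : e ∉ P) :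
    P ∆ {e} = insert e P := by
  ext f; simp only [mem_insert, mem_symmDiff, mem_singleton]
  by_cases hf : f = e
  · subst hf; simp [h]
  · simp [hf]

lemma symmDiff_singleton_eq_erase {α : Type*} [DecidableEq α] {P : Finset α} {e : α} (h : e ∈ P) :
    P ∆ {e} = P.erase e := by
  rw [erase_eq, sdiff_eq_symmDiff_of_subset (singleton_subset_iff.2 h)]

lemma exists_eq_mk_of_mem_cut {D : Finset V} {e : Sym2 V} (he : e ∈ cut D) :
    ∃ a ∈ D, ∃ b ∉ D, e = s(a, b) := by
  induction e with | _ u v =>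
  rw [mk_mem_cut] at he
  by_cases hu : u ∈ D
  · exact ⟨u, hu, v, by tauto, rfl⟩
  · exact ⟨v, by tauto, u, hu, Sym2.eq_swap⟩

lemma mem_oddVerts {F : Finset (Sym2 V)} {v : V} :
    v ∈ oddVerts F ↔ Odd #{e ∈ F | v ∈ e} := by
  simp [oddVerts]

lemma oddVerts_symmDiff (F G : Finset (Sym2 V)) :
    oddVerts (F ∆ G) = oddVerts F ∆ oddVerts G := by
  ext v
  have h : ({e ∈ F ∆ G | v ∈ e} : Finset _) = {e ∈ F | v ∈ e} ∆ {e ∈ G | v ∈ e} := by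
    ext e; simp only [mem_filter, mem_symmDiff]; tauto
  simp only [mem_symmDiff, mem_oddVerts, h, odd_card_symmDiff]
  tauto

lemma oddVerts_empty : oddVerts (∅ : Finset (Sym2 V)) = ∅ := by
  ext v; simp [mem_oddVerts]

lemma oddVerts_singleton {u v : V} (h : u ≠ v) : oddVerts {s(u, v)} = ({u} : Finset V) ∆ {v} := by
  ext w
  rw [mem_oddVerts, filter_singleton]
  simp only [mem_symmDiff, mem_singleton, Sym2.mem_iff]
  split_ifs with h1
  · simp only [card_singleton, odd_one, true_iff]
    rcases h1 with rfl | rfl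
    · exact Or.inl ⟨rfl, h⟩
    · exact Or.inr ⟨rfl, h.symm⟩
  · simp only [card_empty]
    simp
    tauto

/-- A set of edges crosses a cut with the parity of the number of its odd vertices on one side. -/
lemma odd_card_inter_cut {F : Finset (Sym2 V)} (hF : F ⊆ edges V) (S : Finset V) :
    Odd #(F ∩ cut S) ↔ Odd #(oddVerts F ∩ S) := by
  induction F using Finset.induction_on with
  | empty => simp [oddVerts_empty]
  | insert e F he ih =>
    have ih := ih (fun f hf => hF (mem_insert_of_mem hf))
    have hins : insert e F = {e} ∆ F := by
      rw [symmDiff_comm, symmDiff_singleton_eq_insert he]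
    have hedge := hF (mem_insert_self e F)
    rw [hins, oddVerts_symmDiff]
    have h1 : ({e} ∆ F) ∩ cut S = ({e} ∩ cut S) ∆ (F ∩ cut S) := inf_symmDiff_distrib_right ..
    have h2 : (oddVerts {e} ∆ oddVerts F) ∩ S = (oddVerts {e} ∩ S) ∆ (oddVerts F ∩ S) :=
      inf_symmDiff_distrib_right ..
    rw [h1, h2, odd_card_symmDiff, odd_card_symmDiff, ih]
    refine not_congr (iff_congr ?_ Iff.rfl)
    induction e with | _ u v =>
    have huv := mk_mem_edges.1 hedge
    have h3 : (({u} : Finset V) ∆ {v}) ∩ S = ({u} ∩ S) ∆ ({v} ∩ S) :=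
      inf_symmDiff_distrib_right ..
    rw [oddVerts_singleton huv, h3, odd_card_symmDiff]
    have key : ∀ {α : Type _} [DecidableEq α] (a : α) (A : Finset α), Odd #({a} ∩ A) ↔ a ∈ A := by
      intro α _ a A
      by_cases h : a ∈ A <;> simp [h]
    have key' : Odd #({s(u, v)} ∩ cut S) ↔ s(u, v) ∈ cut S := by
      by_cases h : s(u, v) ∈ cut S <;> simp [h]
    rw [key', key, key, mk_mem_cut]

lemma even_card_oddVerts {F : Finset (Sym2 V)} (hF : F ⊆ edges V) : Even #(oddVerts F) := by
  have h := odd_card_inter_cut hF univ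
  have h' : cut (univ : Finset V) = ∅ := by
    ext e
    induction e with | _ u v => simp [mk_mem_cut]
  rw [h', inter_empty, inter_univ] at h
  rw [← Nat.not_odd_iff_even, ← h]
  simp

lemma IsJoin.symmDiff {Q Q' : Finset V} {J J' : Finset (Sym2 V)} (h : IsJoin Q J)
    (h' : IsJoin Q' J') : IsJoin (Q ∆ Q') (J ∆ J') := by
  refine ⟨?_, by rw [oddVerts_symmDiff, h.2, h'.2]⟩
  intro e he
  rcases mem_symmDiff.1 he with he | he
  · exact h.1 he.1
  · exact h'.1 he.1

lemma isJoin_empty : IsJoin (∅ : Finset V) ∅ := ⟨empty_subset _, oddVerts_empty⟩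

lemma isJoin_edge {u v : V} (h : u ≠ v) : IsJoin (({u} : Finset V) ∆ {v}) {s(u, v)} :=
  ⟨by simpa using mk_mem_edges.2 h, oddVerts_singleton h⟩

lemma IsJoin.congr {Q Q' : Finset V} {J : Finset (Sym2 V)} (h : IsJoin Q J) (hQ : Q = Q') :
    IsJoin Q' J := hQ ▸ h

/-- A join of two vertices separated by `D` contains a join, starting at the vertex outside `D`,
that stops when it enters `D`. -/
lemma IsJoin.exists_subset_entering {D : Finset V} {d : V} (hd : d ∈ D) :
    ∀ (n : ℕ) {x : V} {F : Finset (Sym2 V)}, #F = n → x ∉ D →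
      IsJoin (({x} : Finset V) ∆ {d}) F →
      ∃ a ∈ D, ∃ P ⊆ F, IsJoin (({x} : Finset V) ∆ {a}) P ∧ #(P ∩ cut D) = 1 := by
  intro n
  induction n with
  | zero =>
    intro x F hF hx hJ
    rw [card_eq_zero] at hF
    subst hF
    have h := hJ.2
    rw [oddVerts_empty] at h
    have : x ∈ (∅ : Finset V) := by
      rw [h, mem_symmDiff]
      left
      exact ⟨by simp, by rintro h; rw [mem_singleton] at h; subst h; exact hx hd⟩
    simp at this
  | succ n ih =>
    intro x F hF hx hJ
    have hxd : x ≠ d := by rintro rfl; exact hx hd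
    have hmem : x ∈ oddVerts F := by
      rw [hJ.2, mem_symmDiff]; left; simp [hxd]
    rw [mem_oddVerts] at hmem
    obtain ⟨e, he⟩ := card_pos.1 hmem.pos
    rw [mem_filter] at he
    obtain ⟨z, rfl⟩ := he.2
    have heF := he.1
    have hxz : x ≠ z := mk_mem_edges.1 (hJ.1 heF)
    by_cases hz : z ∈ D
    · refine ⟨z, hz, {s(x, z)}, by simpa using heF, isJoin_edge hxz, ?_⟩
      have : s(x, z) ∈ cut D := mk_mem_cut.2 (by tauto)
      rw [singleton_inter_of_mem this, card_singleton]
    · have hsub := symmDiff_singleton_eq_erase heF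
      have hJ' := (hJ.symmDiff (isJoin_edge hxz))
      rw [hsub] at hJ'
      have hQ : (({x} : Finset V) ∆ {d}) ∆ ({x} ∆ {z}) = {z} ∆ {d} := by
        rw [symmDiff_symmDiff_left_cancel, symmDiff_comm]
      obtain ⟨a, ha, P, hP, hPJ, hPc⟩ := ih (by rw [card_erase_of_mem heF, hF]; rfl) hz (hJ'.congr hQ)
      have hnot : s(x, z) ∉ P := fun h => by simpa using hP h
      refine ⟨a, ha, insert s(x, z) P, ?_, ?_, ?_⟩
      · exact insert_subset heF (hP.trans (erase_subset _ _))
      · rw [← symmDiff_singleton_eq_insert hnot, symmDiff_comm P]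
        exact ((isJoin_edge hxz).symmDiff hPJ).congr (symmDiff_symmDiff_mid_cancel ..)
      · rw [insert_inter_of_notMem (by rw [mk_mem_cut]; tauto), hPc]

/-- The change of the weight of `J` under symmetric difference is additive. -/
lemma sum_symmDiff_eq {α : Type*} [DecidableEq α] (J A : Finset α) (c : α → ℤ) :
    ∑ e ∈ J ∆ A, c e = ∑ e ∈ J, c e + ∑ e ∈ A, if e ∈ J then - c e else c e := by
  rw [symmDiff_def, sup_eq_union, sum_union disjoint_sdiff_sdiff]
  have h1 : ∑ e ∈ J \ A, c e + ∑ e ∈ J ∩ A, c e = ∑ e ∈ J, c e := by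
    rw [add_comm]; exact sum_inter_add_sum_sdiff ..
  have h2 : ∑ e ∈ A ∩ J, (if e ∈ J then - c e else c e) +
      ∑ e ∈ A \ J, (if e ∈ J then - c e else c e) = ∑ e ∈ A, if e ∈ J then - c e else c e :=
    sum_inter_add_sum_sdiff ..
  have h3 : ∑ e ∈ A ∩ J, (if e ∈ J then - c e else c e) = - ∑ e ∈ J ∩ A, c e := by
    rw [inter_comm, ← sum_neg_distrib]
    exact sum_congr rfl fun e he => by simp [(mem_inter.1 he).1]
  have h4 : ∑ e ∈ A \ J, (if e ∈ J then - c e else c e) = ∑ e ∈ A \ J, c e :=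
    sum_congr rfl fun e he => by simp [(mem_sdiff.1 he).2]
  linarith

/-- Each element of `F` changes the weight of `J` independently of the others, so an exchange may be
split into two partial exchanges. A bound on one of them then yields a bound on the other. -/
lemma sum_symmDiff_add {α : Type*} [DecidableEq α] (J F P : Finset α) (hP : P ⊆ F) (c : α → ℤ) :
    ∑ e ∈ J ∆ F, c e + ∑ e ∈ J, c e = ∑ e ∈ J ∆ P, c e + ∑ e ∈ J ∆ (F \ P), c e := by
  rw [sum_symmDiff_eq J F, sum_symmDiff_eq J P, sum_symmDiff_eq J (F \ P),
    ← sum_sdiff hP]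
  ring

lemma sum_symmDiff_of_zero {α : Type*} [DecidableEq α] (J Z : Finset α) (c : α → ℤ)
    (hZ : ∀ e ∈ Z, c e = 0) : ∑ e ∈ J ∆ Z, c e = ∑ e ∈ J, c e := by
  rw [sum_symmDiff_eq, sum_eq_zero (s := Z), add_zero]
  intro e he
  simp [hZ e he]

end Joins

/-! ### Fractional covers of `Q`-cuts versus shortest `Q`-joins. -/

section Duality

variable {V : Type*} [Fintype V] [DecidableEq V]

lemma sum_sub_cut (c : Sym2 V → ℤ) (D : Finset V) (A : Finset (Sym2 V)) :
    ∑ e ∈ A, (c e - if e ∈ cut D then 1 else 0) = ∑ e ∈ A, c e - #(A ∩ cut D) := by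
  rw [sum_sub_distrib, sum_ite_mem, sum_const, nsmul_eq_mul, mul_one]

/-- If even edge sets have even weight, then the weights of any two `Q`-joins have equal parity. -/
lemma IsJoin.even_sub {c : Sym2 V → ℤ} (hpar : ∀ F, IsJoin (∅ : Finset V) F → Even (∑ e ∈ F, c e))
    {Q : Finset V} {A B : Finset (Sym2 V)} (hA : IsJoin Q A) (hB : IsJoin Q B) :
    Even (∑ e ∈ B, c e - ∑ e ∈ A, c e) := by
  have h := hpar _ ((hA.symmDiff hB).congr (symmDiff_self Q))
  rw [sum_symmDiff_eq] at h
  have h2 : ∑ e ∈ B, (if e ∈ A then - c e else c e) =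
      ∑ e ∈ B, c e - 2 * ∑ e ∈ B ∩ A, c e := by
    rw [mul_sum, ← sum_ite_mem, ← sum_sub_distrib]
    exact sum_congr rfl fun e _ => by split_ifs <;> ring
  rw [h2] at h
  obtain ⟨k, hk⟩ := h
  exact ⟨k - ∑ e ∈ A, c e + ∑ e ∈ B ∩ A, c e, by linarith⟩

/-- For a shortest `Q`-join of positive integral weight there is a `Q`-cut such that decreasing all
weights in the cut by one decreases the minimum weight of a `Q`-join by at most one. -/
lemma exists_cut_of_shortest_join {c : Sym2 V → ℤ} (hc : ∀ e ∈ edges V, 0 ≤ c e)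
    (hpar : ∀ F, IsJoin (∅ : Finset V) F → Even (∑ e ∈ F, c e))
    {Q : Finset V} {J : Finset (Sym2 V)} (hJ : IsJoin Q J)
    (hmin : ∀ J', IsJoin Q J' → ∑ e ∈ J, c e ≤ ∑ e ∈ J', c e) (hpos : 0 < ∑ e ∈ J, c e) :
    ∃ D : Finset V, (∀ e ∈ cut D, 1 ≤ c e) ∧ Odd #(Q ∩ D) ∧ #(J ∩ cut D) = 1 ∧
      ∀ J', IsJoin Q J' → ∑ e ∈ J, c e - 1 ≤ ∑ e ∈ J', (c e - if e ∈ cut D then 1 else 0) := by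
  classical
  obtain ⟨e₀, he₀J, he₀⟩ : ∃ e ∈ J, 0 < c e := by
    by_contra! h
    exact absurd (sum_nonpos h) (not_le.2 hpos)
  induction e₀ with | _ x v₀ =>
  have hxv : x ≠ v₀ := mk_mem_edges.1 (hJ.1 he₀J)
  -- a cheapest join among those that differ from a `Q`-join by moving the parity at `x`
  obtain ⟨⟨d, K⟩, hK, hKmin⟩ := exists_min_image
    (univ.filter fun q : V × Finset (Sym2 V) => IsJoin (Q ∆ ({x} ∆ {q.1})) q.2)
    (fun q => ∑ e ∈ q.2, c e)
    ⟨(x, J), by simpa [← bot_eq_empty] using hJ⟩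
  simp only [mem_filter, mem_univ, true_and, Prod.forall] at hK hKmin
  have hKlt : ∑ e ∈ K, c e < ∑ e ∈ J, c e := by
    have h1 := hKmin v₀ (J ∆ {s(x, v₀)}) (hJ.symmDiff (isJoin_edge hxv))
    rw [sum_symmDiff_eq, sum_singleton, if_pos he₀J] at h1
    linarith
  -- `D` is the component of `d` in the graph of zero-weight edges, so all edges leaving it have
  -- weight at least 1 and ends inside it can be moved for free.
  set D : Finset V := univ.filter fun v => ∃ Z, IsJoin (({d} : Finset V) ∆ {v}) Z ∧ ∀ e ∈ Z, c e = 0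
    with hD
  have memD : ∀ v, v ∈ D ↔ ∃ Z, IsJoin (({d} : Finset V) ∆ {v}) Z ∧ ∀ e ∈ Z, c e = 0 := by
    simp [hD]
  have hdD : d ∈ D := (memD d).2 ⟨∅, isJoin_empty.congr (by simp), by simp⟩
  have zero_join : ∀ a ∈ D, ∀ b ∈ D, ∃ Z, IsJoin (({a} : Finset V) ∆ {b}) Z ∧ ∀ e ∈ Z, c e = 0 := by
    intro a ha b hb
    obtain ⟨Z, hZ, hZ0⟩ := (memD a).1 ha
    obtain ⟨Z', hZ', hZ0'⟩ := (memD b).1 hb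
    refine ⟨Z ∆ Z', (hZ.symmDiff hZ').congr ?_, ?_⟩
    · exact symmDiff_symmDiff_left_cancel ..
    · intro e he
      rcases mem_symmDiff.1 he with he | he
      · exact hZ0 e he.1
      · exact hZ0' e he.1
  have hxD : x ∉ D := by
    intro hx
    obtain ⟨Z, hZ, hZ0⟩ := (memD x).1 hx
    have h := hmin (K ∆ Z) ((hK.symmDiff hZ).congr (by
      rw [symmDiff_comm ({d} : Finset V), symmDiff_symmDiff_cancel_right]))
    rw [sum_symmDiff_of_zero _ _ _ hZ0] at h
    linarith
  have hcut' : ∀ a ∈ D, ∀ b ∉ D, 1 ≤ c s(a, b) := by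
    intro a ha b hb
    have hab : a ≠ b := by rintro rfl; exact hb ha
    by_contra! h
    have h0 : c s(a, b) = 0 := le_antisymm (by omega) (hc _ (mk_mem_edges.2 hab))
    obtain ⟨Z, hZ, hZ0⟩ := (memD a).1 ha
    refine hb ((memD b).2 ⟨Z ∆ {s(a, b)}, (hZ.symmDiff (isJoin_edge hab)).congr ?_, ?_⟩)
    · exact symmDiff_symmDiff_mid_cancel ..
    · intro e he
      rcases mem_symmDiff.1 he with he | he
      · exact hZ0 e he.1
      · rw [mem_singleton.1 he.1]; exact h0
  have hcut : ∀ e ∈ cut D, 1 ≤ c e := by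
    intro e he
    obtain ⟨a, ha, b, hb, rfl⟩ := exists_eq_mk_of_mem_cut he
    exact hcut' a ha b hb
  have zero_cut : ∀ {Z : Finset (Sym2 V)}, (∀ e ∈ Z, c e = 0) → ∀ e ∈ Z, e ∉ cut D := by
    intro Z hZ e he hec
    have := hcut e hec
    rw [hZ e he] at this
    omega
  -- joins attaining the minimum do not cross `D`
  have not_cross : ∀ a ∈ D, ∀ K', IsJoin (Q ∆ ({x} ∆ {a})) K' → ∑ e ∈ K', c e ≤ ∑ e ∈ K, c e →
      K' ∩ cut D = ∅ := by
    intro a ha K' hK' hle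
    by_contra hne
    obtain ⟨e, he⟩ := nonempty_iff_ne_empty.2 hne
    obtain ⟨heK, hec⟩ := mem_inter.1 he
    obtain ⟨p, hp, q, hq, rfl⟩ := exists_eq_mk_of_mem_cut hec
    have hpq : p ≠ q := by rintro rfl; exact hq hp
    obtain ⟨Z, hZ, hZ0⟩ := zero_join a ha p hp
    have h := hKmin q ((K' ∆ {s(p, q)}) ∆ Z) (((hK'.symmDiff (isJoin_edge hpq)).symmDiff hZ).congr
      (symmDiff_move_endpoint ..))
    rw [sum_symmDiff_of_zero _ _ _ hZ0, sum_symmDiff_eq, sum_singleton, if_pos heK] at h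
    have := hcut _ hec
    linarith
  have inter_cut : ∀ A B : Finset (Sym2 V), (A ∆ B) ∩ cut D = (A ∩ cut D) ∆ (B ∩ cut D) :=
    fun A B => inf_symmDiff_distrib_right ..
  -- every shortest `Q`-join crosses `D` exactly once
  have cross_one : ∀ J', IsJoin Q J' → ∑ e ∈ J', c e ≤ ∑ e ∈ J, c e → #(J' ∩ cut D) = 1 := by
    intro J' hJ' hle
    have hF : IsJoin (({x} : Finset V) ∆ {d}) (J' ∆ K) := (hJ'.symmDiff hK).congr (by
      rw [symmDiff_symmDiff_cancel_left])
    obtain ⟨a, ha, P, hPF, hP, hPc⟩ := hF.exists_subset_entering hdD _ rfl hxD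
    obtain ⟨Z, hZ, hZ0⟩ := zero_join d hdD a ha
    have hsd := sdiff_eq_symmDiff_of_subset hPF
    -- Exchanging all of `J' ∆ K` turns `J'` into `K`. Its part outside `P`, closed up by `Z`, leads
    -- to another `Q`-join and cannot gain; hence `J' ∆ P` is no heavier than `K` and does not cross
    -- `D`.
    have h1 := hmin ((J' ∆ ((J' ∆ K) \ P)) ∆ Z) (by
      rw [hsd]
      refine ((hJ'.symmDiff (hF.symmDiff hP)).symmDiff hZ).congr ?_
      rw [symmDiff_symmDiff_left_cancel, symmDiff_symmDiff_cancel_right])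
    rw [sum_symmDiff_of_zero _ _ _ hZ0] at h1
    have h2 := sum_symmDiff_add J' (J' ∆ K) P hPF c
    rw [symmDiff_symmDiff_cancel_left] at h2
    have h3 := not_cross a ha (J' ∆ P) (hJ'.symmDiff hP) (by linarith)
    rw [inter_cut] at h3
    have h4 : J' ∩ cut D = P ∩ cut D := symmDiff_eq_bot.1 h3
    rw [h4, hPc]
  have hJ1 := cross_one J hJ le_rfl
  have hQD : Odd #(Q ∩ D) := by
    rw [← hJ.2, ← odd_card_inter_cut hJ.1, hJ1]
    exact odd_one
  refine ⟨D, hcut, hQD, hJ1, ?_⟩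
  -- Induction on the crossings of `J ∆ J'` with the cut: a piece crossing exactly twice is split
  -- off, and the two exchanges are bounded separately.
  suffices H : ∀ n, ∀ J', IsJoin Q J' → #((J ∆ J') ∩ cut D) ≤ n →
      ∑ e ∈ J, c e - 1 ≤ ∑ e ∈ J', (c e - if e ∈ cut D then 1 else 0) from
    fun J' hJ' => H _ J' hJ' le_rfl
  intro n
  induction n with
  | zero =>
    intro J' hJ' h0
    have h1 : J ∩ cut D = J' ∩ cut D := by
      have := card_eq_zero.1 (Nat.le_zero.1 h0)
      rw [inter_cut] at this
      exact symmDiff_eq_bot.1 this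
    rw [sum_sub_cut, ← h1, hJ1]
    have := hmin J' hJ'
    push_cast
    linarith
  | succ n ih =>
    intro J' hJ' hn
    by_cases hle : #((J ∆ J') ∩ cut D) ≤ n
    · exact ih J' hJ' hle
    have hF : IsJoin ∅ (J ∆ J') := (hJ.symmDiff hJ').congr (symmDiff_self Q)
    obtain ⟨f, hf⟩ : ((J ∆ J') ∩ cut D).Nonempty := card_pos.1 (by omega)
    obtain ⟨hfF, hfc⟩ := mem_inter.1 hf
    obtain ⟨a, ha, b, hb, rfl⟩ := exists_eq_mk_of_mem_cut hfc
    have hab : a ≠ b := by rintro rfl; exact hb ha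
    have hF' : IsJoin (({b} : Finset V) ∆ {a}) ((J ∆ J') ∆ {s(a, b)}) :=
      (hF.symmDiff (isJoin_edge hab)).congr (by rw [← bot_eq_empty, bot_symmDiff, symmDiff_comm])
    obtain ⟨a', ha', P, hPF, hP, hPc⟩ := hF'.exists_subset_entering ha _ rfl hb
    rw [symmDiff_singleton_eq_erase hfF] at hPF
    have hfP : s(a, b) ∉ P := fun h => by simpa using hPF h
    have hCF : P ∆ {s(a, b)} ⊆ J ∆ J' := by
      rw [symmDiff_singleton_eq_insert hfP]
      exact insert_subset hfF (hPF.trans (erase_subset _ _))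
    have hC : IsJoin (({a} : Finset V) ∆ {a'}) (P ∆ {s(a, b)}) :=
      (hP.symmDiff (isJoin_edge hab)).congr (by
        rw [symmDiff_comm, symmDiff_symmDiff_mid_cancel])
    set C := P ∆ {s(a, b)} with hCdef
    have hCc : #(C ∩ cut D) = 2 := by
      have hins : C ∩ cut D = insert s(a, b) (P ∩ cut D) := by
        rw [hCdef, symmDiff_singleton_eq_insert hfP, insert_inter_of_mem hfc]
      rw [hins, card_insert_of_notMem (by simp [hfP]), hPc]
    obtain ⟨Z, hZ, hZ0⟩ := zero_join a ha a' ha'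
    have hZ0' : ∀ e ∈ Z, (c e - if e ∈ cut D then 1 else 0) = 0 := by
      intro e he
      rw [if_neg (zero_cut hZ0 e he), hZ0 e he, sub_zero]
    have hZcut : Z ∩ cut D = ∅ := by
      ext e
      simp only [mem_inter, notMem_empty, iff_false, not_and]
      exact zero_cut hZ0 e
    have hsd := sdiff_eq_symmDiff_of_subset hCF
    -- the closed part through the chosen edge
    have hA : IsJoin Q ((J ∆ C) ∆ Z) := ((hJ.symmDiff hC).symmDiff hZ).congr
      (symmDiff_symmDiff_cancel_right ..)
    have hA1 : ∑ e ∈ J, c e - 1 ≤ ∑ e ∈ (J ∆ C) ∆ Z, (c e - if e ∈ cut D then 1 else 0) := by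
      rw [sum_sub_cut]
      have hcard : #(((J ∆ C) ∆ Z) ∩ cut D) ≤ 3 := by
        rw [inter_cut, hZcut, inter_cut]
        have : ((J ∩ cut D) ∆ (C ∩ cut D)) ∆ ∅ ⊆ (J ∩ cut D) ∪ (C ∩ cut D) := by
          rw [← bot_eq_empty, symmDiff_bot]
          exact symmDiff_le_sup
        refine (card_le_card this).trans ((card_union_le _ _).trans ?_)
        omega
      have hodd : Odd #(((J ∆ C) ∆ Z) ∩ cut D) := by
        rw [odd_card_inter_cut hA.1, hA.2]; exact hQD
      have hm := hmin _ hA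
      have hev := hJ.even_sub hpar hA
      -- Minimum joins cross once and lose exactly 1. Any other join exceeds the minimum by at least
      -- 2, by parity, and loses at most 3.
      rcases hm.eq_or_lt with heq | hlt
      · rw [cross_one _ hA heq.symm.le, heq]
        simp
      · obtain ⟨k, hk⟩ := hev
        have : (#(((J ∆ C) ∆ Z) ∩ cut D) : ℤ) ≤ 3 := by exact_mod_cast hcard
        omega
    -- the rest, which crosses `D` less often
    have hB : IsJoin Q ((J ∆ ((J ∆ J') \ C)) ∆ Z) := by
      rw [hsd]
      refine ((hJ.symmDiff (hF.symmDiff hC)).symmDiff hZ).congr ?_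
      rw [← bot_eq_empty, bot_symmDiff, symmDiff_symmDiff_cancel_right]
    have hB1 := ih _ hB (by
      have h1 : J ∆ ((J ∆ ((J ∆ J') \ C)) ∆ Z) = ((J ∆ J') \ C) ∆ Z := by
        rw [← symmDiff_assoc, symmDiff_symmDiff_cancel_left]
      rw [h1, inter_cut, hZcut]
      have h2 : (((J ∆ J') \ C) ∩ cut D) ∆ ∅ = ((J ∆ J') ∩ cut D) \ (C ∩ cut D) := by
        rw [← bot_eq_empty, symmDiff_bot]
        exact inf_sdiff_distrib_right ..
      rw [h2, card_sdiff_of_subset (inter_subset_inter_right hCF), hCc]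
      omega)
    rw [sum_symmDiff_of_zero _ _ _ hZ0'] at hA1 hB1
    have hsum := sum_symmDiff_add J (J ∆ J') C hCF (fun e => c e - if e ∈ cut D then 1 else 0)
    rw [symmDiff_symmDiff_cancel_left] at hsum
    have hJs := sum_sub_cut c D J
    rw [hJ1] at hJs
    push_cast at hJs
    linarith

/-- Integral case of the description of the dominant of the `Q`-join polytope. -/
lemma shortest_join_le_int {Q : Finset V} {J : Finset (Sym2 V)} (hJ : IsJoin Q J)
    {z : Sym2 V → ℝ} (hz : ∀ e ∈ edges V, 0 ≤ z e)
    (hzcut : ∀ S : Finset V, Odd #(Q ∩ S) → 1 ≤ ∑ e ∈ cut S, z e) (n : ℕ) :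
    ∀ {c : Sym2 V → ℤ}, (∀ e ∈ edges V, 0 ≤ c e) →
      (∀ F, IsJoin (∅ : Finset V) F → Even (∑ e ∈ F, c e)) →
      (∀ J', IsJoin Q J' → ∑ e ∈ J, c e ≤ ∑ e ∈ J', c e) → ∑ e ∈ J, c e = n →
      (n : ℝ) ≤ ∑ e ∈ edges V, c e * z e := by
  induction n with
  | zero =>
    intro c hc _ _ _
    simpa using sum_nonneg fun e he => mul_nonneg (Int.cast_nonneg (hc e he)) (hz e he)
  | succ n ih =>
    intro c hc hpar hmin hn
    obtain ⟨D, hcut, hQD, hJ1, hD⟩ := exists_cut_of_shortest_join hc hpar hJ hmin (by rw [hn]; positivity)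
    have hJs := sum_sub_cut c D J
    rw [hJ1] at hJs
    -- `J` stays shortest for the reduced weights and loses exactly 1, whereas the right-hand side
    -- loses the `z`-weight of a `Q`-cut, at least 1. Evenness survives because even edge sets cross
    -- every cut evenly.
    have h := ih (c := fun e => c e - if e ∈ cut D then 1 else 0) ?_ ?_ ?_ ?_
    · have h1 : ∑ e ∈ edges V, ((c e - if e ∈ cut D then 1 else 0 : ℤ) : ℝ) * z e =
          ∑ e ∈ edges V, c e * z e - ∑ e ∈ cut D, z e := by
        have h2 : ∑ e ∈ cut D, z e = ∑ e ∈ edges V, if e ∈ cut D then z e else 0 := by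
          rw [sum_ite_mem, inter_eq_right.2 (cut_subset_edges D)]
        rw [h2, ← sum_sub_distrib]
        refine sum_congr rfl fun e _ => ?_
        split_ifs <;> push_cast <;> ring
      rw [h1] at h
      have := hzcut D hQD
      push_cast
      linarith
    · intro e he
      show 0 ≤ c e - _
      split_ifs with h
      · have := hcut e h; omega
      · have := hc e he; omega
    · intro F hF
      rw [sum_sub_cut]
      refine (hpar F hF).sub ?_
      have := odd_card_inter_cut hF.1 D
      rw [hF.2] at this
      simpa using this
    · intro J' hJ'
      have := hD J' hJ'
      rw [hJs]
      push_cast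
      exact this
    · rw [hJs, hn]; push_cast; ring

/-- A vector that covers every `Q`-cut is at least as long as a shortest `Q`-join. -/
theorem IsShortestJoin.le_of_covers_cuts {c : Sym2 V → ℝ} (hc : ∀ e, 0 ≤ c e)
    {Q : Finset V} {J : Finset (Sym2 V)} (hJ : IsShortestJoin c Q J)
    {z : Sym2 V → ℝ} (hz : ∀ e ∈ edges V, 0 ≤ z e)
    (hzcut : ∀ S : Finset V, Odd #(Q ∩ S) → 1 ≤ ∑ e ∈ cut S, z e) :
    ∑ e ∈ J, c e ≤ ∑ e ∈ edges V, c e * z e := by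
  classical
  have approx : ∀ N : ℕ, 0 < N →
      N * ∑ e ∈ J, c e ≤ N * ∑ e ∈ edges V, c e * z e + ∑ e ∈ edges V, z e := by
    intro N hN
    -- Doubling secures the parity condition; rounding up costs at most `∑ z e` in total (before
    -- doubling), which is negligible against `N`.
    set c' : Sym2 V → ℤ := fun e => 2 * ⌈N * c e⌉ with hc'
    have hc'0 : ∀ e, 0 ≤ c' e := fun e => by
      have : 0 ≤ ⌈N * c e⌉ := Int.ceil_nonneg (mul_nonneg (Nat.cast_nonneg _) (hc e))
      simp only [hc']; omega
    obtain ⟨J', hJ', hmin⟩ := exists_min_image (univ.filter fun K => IsJoin Q K)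
      (fun K => ∑ e ∈ K, c' e) ⟨J, by simpa using hJ.1⟩
    simp only [mem_filter, mem_univ, true_and] at hJ' hmin
    have h := shortest_join_le_int hJ' hz hzcut (∑ e ∈ J', c' e).toNat (c := c')
      (fun e _ => hc'0 e)
      (fun F _ => by rw [hc', ← mul_sum]; exact even_two_mul _) hmin
      (Int.toNat_of_nonneg (sum_nonneg fun e _ => hc'0 e)).symm
    have h1 : (((∑ e ∈ J', c' e).toNat : ℕ) : ℝ) = ∑ e ∈ J', (c' e : ℝ) := by
      have := Int.toNat_of_nonneg (sum_nonneg fun e (_ : e ∈ J') => hc'0 e)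
      rw [← Int.cast_natCast, this]; push_cast; rfl
    rw [h1] at h
    have hlow : ∑ e ∈ J', 2 * (N * c e) ≤ ∑ e ∈ J', (c' e : ℝ) := sum_le_sum fun e _ => by
      simp only [hc']; push_cast
      have := Int.le_ceil (N * c e)
      linarith
    have hup : ∑ e ∈ edges V, (c' e : ℝ) * z e ≤ ∑ e ∈ edges V, (2 * (N * (c e * z e)) + 2 * z e) :=
      sum_le_sum fun e he => by
        simp only [hc']; push_cast
        have h1 := (Int.ceil_lt_add_one (N * c e)).le
        have h2 := mul_le_mul_of_nonneg_right h1 (hz e he)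
        linarith
    rw [← mul_sum, ← mul_sum] at hlow
    rw [sum_add_distrib, ← mul_sum, ← mul_sum, ← mul_sum] at hup
    have h3 := mul_le_mul_of_nonneg_left (hJ.2 J' hJ') (Nat.cast_nonneg (α := ℝ) N)
    linarith
  by_contra! hlt
  obtain ⟨N, hN⟩ := exists_nat_gt ((∑ e ∈ edges V, z e) / (∑ e ∈ J, c e - ∑ e ∈ edges V, c e * z e))
  rw [div_lt_iff₀ (sub_pos.2 hlt)] at hN
  have hN0 : 0 < N := by
    rcases Nat.eq_zero_or_pos N with rfl | h
    · have := sum_nonneg hz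
      simp at hN; linarith
    · exact h
  have := approx N hN0
  linarith

end Duality

/-! ### Fundamental cuts, peaks and cores of trees. -/

section Trees

variable {V : Type*}

/-- Connectivity as an induction principle, which avoids explicit paths in later arguments. -/
lemma verts_subset_of_closed {H : Subgr V} (hH : H.coe.Connected) {r : V} (hr : r ∈ H.verts)
    {X : Set V} (hrX : r ∈ X) (hX : ∀ a b, H.Adj a b → a ∈ X → b ∈ X) : H.verts ⊆ X := by
  intro v hv
  obtain ⟨p⟩ := hH.preconnected ⟨r, hr⟩ ⟨v, hv⟩
  have key : ∀ {a b : H.verts}, H.coe.Walk a b → a.1 ∈ X → b.1 ∈ X := by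
    intro a b q
    induction q with
    | nil => exact id
    | cons h _ ih => exact fun ha => ih (hX _ _ h ha)
  exact key p hrX

lemma connected_of_closed {H : Subgr V} {r : V} (hr : r ∈ H.verts)
    (h : ∀ X : Set V, r ∈ X → (∀ a b, H.Adj a b → a ∈ X → b ∈ X) → H.verts ⊆ X) :
    H.coe.Connected := by
  rw [SimpleGraph.connected_iff_exists_forall_reachable]
  refine ⟨⟨r, hr⟩, fun ⟨v, hv⟩ => ?_⟩
  obtain ⟨_, h'⟩ := h {v | ∃ hv : v ∈ H.verts, H.coe.Reachable ⟨r, hr⟩ ⟨v, hv⟩} ⟨hr, .refl _⟩ (by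
    rintro a b hab ⟨ha, hra⟩
    refine ⟨H.edge_vert hab.symm, hra.trans (SimpleGraph.Adj.reachable ?_)⟩
    exact hab) hv
  exact h'

lemma IsCore.root_mem {y : V → ℝ} {T₀ T : Subgr V} {γ : ℝ} (h : IsCore y T₀ γ T) {r : V}
    (hr : r ∈ T₀.verts) (hγ : γ ≤ y r) : r ∈ T.verts :=
  h.prop.2.2 r hr hγ

variable [Fintype V] [DecidableEq V]

lemma mem_subEdges {T : Subgr V} {e : Sym2 V} : e ∈ subEdges T ↔ e ∈ T.edgeSet := by
  simp [subEdges]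

lemma subEdges_subset_edges (T : Subgr V) : subEdges T ⊆ edges V := by
  intro e he
  rw [mem_subEdges] at he
  induction e with | _ u v =>
  exact mk_mem_edges.2 (T.adj_sub (SimpleGraph.Subgraph.mem_edgeSet.1 he))

/-- Every edge of a tree is the only edge of the tree in some cut. -/
lemma exists_fundamental_cut {T : Subgr V} (hT : T.coe.IsTree) (r : V) {e : Sym2 V}
    (he : e ∈ T.edgeSet) :
    ∃ S : Finset V, r ∉ S ∧ ∀ f ∈ T.edgeSet, f ∈ cut S ↔ f = e := by
  classical
  suffices h : ∃ S : Finset V, ∀ f ∈ T.edgeSet, f ∈ cut S ↔ f = e by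
    obtain ⟨S, hS⟩ := h
    by_cases hr : r ∈ S
    · exact ⟨Sᶜ, by simpa using hr, by simpa only [cut_compl] using hS⟩
    · exact ⟨S, hr, hS⟩
  induction e with | _ a b =>
  have hab : T.Adj a b := SimpleGraph.Subgraph.mem_edgeSet.1 he
  have ha := T.edge_vert hab
  have hb := T.edge_vert hab.symm
  have hbr := SimpleGraph.isAcyclic_iff_forall_adj_isBridge.1 hT.isAcyclic
    (show T.coe.Adj ⟨a, ha⟩ ⟨b, hb⟩ from hab)
  rw [SimpleGraph.isBridge_iff] at hbr
  set G := T.coe.deleteEdges {s((⟨a, ha⟩ : T.verts), (⟨b, hb⟩ : T.verts))} with hG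
  set S : Finset V := univ.filter fun v => ∃ hv : v ∈ T.verts, G.Reachable ⟨a, ha⟩ ⟨v, hv⟩ with hS
  have memS : ∀ v, v ∈ S ↔ ∃ hv : v ∈ T.verts, G.Reachable ⟨a, ha⟩ ⟨v, hv⟩ := by simp [hS]
  have haS : a ∈ S := (memS a).2 ⟨ha, .refl _⟩
  have hbS : b ∉ S := fun h => by
    obtain ⟨_, h⟩ := (memS b).1 h
    exact hbr h
  have step : ∀ u v, T.Adj u v → s(u, v) ≠ s(a, b) → u ∈ S → v ∈ S := by
    intro u v huv hne hu
    obtain ⟨hu', hu⟩ := (memS u).1 hu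
    refine (memS v).2 ⟨T.edge_vert huv.symm, hu.trans (SimpleGraph.Adj.reachable ?_)⟩
    rw [hG, SimpleGraph.deleteEdges_adj]
    refine ⟨huv, fun h => hne ?_⟩
    rw [Set.mem_singleton_iff] at h
    simpa using congrArg (Sym2.map Subtype.val) h
  refine ⟨S, fun f hf => ?_⟩
  induction f with | _ u v =>
  have huv : T.Adj u v := SimpleGraph.Subgraph.mem_edgeSet.1 hf
  constructor
  · intro h
    by_contra hne
    rw [mk_mem_cut] at h
    exact h ⟨step u v huv hne, step v u huv.symm (by rwa [Sym2.eq_swap])⟩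
  · intro h
    rw [h, mk_mem_cut]
    tauto

/-- `v` has maximum value among the vertices of the tree `T` that are separated from `r` by the
edge `e`. -/
def IsPeak (r : V) (y : V → ℝ) (T : Subgr V) (e : Sym2 V) (v : V) : Prop :=
  v ∈ T.verts ∧ ∃ S : Finset V, r ∉ S ∧ v ∈ S ∧ (∀ f ∈ T.edgeSet, f ∈ cut S ↔ f = e) ∧
    ∀ u ∈ T.verts, u ∈ S → y u ≤ y v

lemma exists_mem_verts_of_mem_cut {T : Subgr V} {e : Sym2 V} (he : e ∈ T.edgeSet) {S : Finset V}
    (heS : e ∈ cut S) : ∃ v ∈ T.verts, v ∈ S := by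
  obtain ⟨a, ha, b, hb, rfl⟩ := exists_eq_mk_of_mem_cut heS
  exact ⟨a, T.edge_vert (SimpleGraph.Subgraph.mem_edgeSet.1 he), ha⟩

lemma exists_isPeak {T : Subgr V} (hT : T.coe.IsTree) (r : V) (y : V → ℝ) {e : Sym2 V}
    (he : e ∈ T.edgeSet) : ∃ v, IsPeak r y T e v := by
  classical
  obtain ⟨S, hr, hS⟩ := exists_fundamental_cut hT r he
  obtain ⟨v₀, hv₀, hv₀S⟩ := exists_mem_verts_of_mem_cut he ((hS e he).2 rfl)
  obtain ⟨v, hv, hmax⟩ := exists_max_image (S.filter fun v => v ∈ T.verts) y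
    ⟨v₀, by simp [hv₀, hv₀S]⟩
  simp only [mem_filter] at hv hmax
  exact ⟨v, hv.2, S, hr, hv.1, hS, fun u hu huS => hmax u ⟨huS, hu⟩⟩

/-- Deleting the far side of an edge from a subtree leaves a tree. -/
lemma isTree_deleteVerts {T : Subgr V} (hT : T.coe.IsTree) {r : V} (hr : r ∈ T.verts) {e : Sym2 V}
    {S : Finset V} (hrS : r ∉ S) (hS : ∀ f ∈ T.edgeSet, f ∈ cut S → f = e) :
    (T.deleteVerts (S : Set V)).coe.IsTree := by
  have hr' : r ∈ (T.deleteVerts (S : Set V)).verts := by simp [hr, hrS]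
  refine ⟨connected_of_closed hr' ?_, ?_⟩
  · intro X hrX hX
    have hcr : ∀ a b, T.Adj a b → a ∉ S → b ∈ S → e = s(a, b) := by
      intro a b hab ha hb
      exact (hS s(a, b) (SimpleGraph.Subgraph.mem_edgeSet.2 hab) (mk_mem_cut.2 (by tauto))).symm
    have hX' : ∀ a b, T.Adj a b → a ∉ S → b ∉ S → a ∈ X → b ∈ X := by
      intro a b hab ha hb
      refine hX a b ?_
      rw [SimpleGraph.Subgraph.deleteVerts_adj]
      exact ⟨T.edge_vert hab, ha, T.edge_vert hab.symm, hb, hab⟩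
    -- the far side is added to `X` if and only if the near end of `e` belongs to `X`
    have hsub := verts_subset_of_closed hT.connected hr
      (X := {v | (v ∉ S ∧ v ∈ X) ∨ (v ∈ S ∧ ∃ a ∈ X, a ∉ S ∧ ∃ b ∈ S, e = s(a, b))})
      (Or.inl ⟨hrS, hrX⟩) (by
        rintro a b hab (⟨haS, haX⟩ | ⟨haS, p, hp, hpS, q, hq, he⟩)
        · by_cases hb : b ∈ S
          · exact Or.inr ⟨hb, a, haX, haS, b, hb, hcr a b hab haS hb⟩
          · exact Or.inl ⟨hb, hX' a b hab haS hb haX⟩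
        · by_cases hb : b ∈ S
          · exact Or.inr ⟨hb, p, hp, hpS, q, hq, he⟩
          · refine Or.inl ⟨hb, ?_⟩
            have h := hcr b a hab.symm hb haS
            rw [he, Sym2.eq_iff] at h
            rcases h with ⟨rfl, rfl⟩ | ⟨rfl, rfl⟩
            · exact hp
            · exact absurd haS hpS)
    intro v hv
    rw [SimpleGraph.Subgraph.deleteVerts_verts] at hv
    rcases hsub hv.1 with h | h
    · exact h.2
    · exact absurd h.1 hv.2
  · exact hT.isAcyclic.comap (SimpleGraph.Subgraph.inclusion SimpleGraph.Subgraph.deleteVerts_le)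
      (SimpleGraph.Subgraph.inclusion.injective _)

/-- If all values beyond `e` were below `γ`, deleting that side would leave a smaller admissible
subtree, contradicting minimality. -/
lemma IsCore.le_peak {y : V → ℝ} {T₀ T : Subgr V} {γ : ℝ} (h : IsCore y T₀ γ T) {r : V}
    (hr : r ∈ T₀.verts) (hγ : γ ≤ y r) {e : Sym2 V} (he : e ∈ T.edgeSet) {v : V}
    (hv : IsPeak r y T₀ e v) : γ ≤ y v := by
  by_contra! hlt
  obtain ⟨-, S, hrS, -, hS, hmax⟩ := hv
  have hle := h.prop.1
  have hT' := isTree_deleteVerts h.prop.2.1 (h.root_mem hr hγ) hrS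
    (fun f hf hfS => (hS f (SimpleGraph.Subgraph.edgeSet_mono hle hf)).1 hfS)
  have hle' := h.le_of_le ⟨SimpleGraph.Subgraph.deleteVerts_le.trans hle, hT', fun u hu hγu => by
    rw [SimpleGraph.Subgraph.deleteVerts_verts]
    refine ⟨h.prop.2.2 u hu hγu, fun huS => ?_⟩
    have := hmax u hu huS
    linarith⟩ SimpleGraph.Subgraph.deleteVerts_le
  obtain ⟨u, hu, huS⟩ := exists_mem_verts_of_mem_cut he
    ((hS e (SimpleGraph.Subgraph.edgeSet_mono hle he)).2 rfl)
  have := hle'.1 hu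
  rw [SimpleGraph.Subgraph.deleteVerts_verts] at this
  exact this.2 huS

/-- A cut that a tree crosses only in `e` separates the root from the peak of `e`. -/
lemma IsCore.peak_mem {y : V → ℝ} {T₀ T : Subgr V} {γ : ℝ} (h : IsCore y T₀ γ T) {r : V}
    (hr : r ∈ T₀.verts) (hγ : γ ≤ y r) {e : Sym2 V} (he : e ∈ T.edgeSet) {v : V}
    (hv : IsPeak r y T₀ e v) {S : Finset V} (hrS : r ∉ S)
    (hS : ∀ f ∈ T.edgeSet, f ∈ cut S ↔ f = e) : v ∈ S := by
  have hγv := h.le_peak hr hγ he hv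
  obtain ⟨hvT, S', hrS', hvS', hS', -⟩ := hv
  have hvT' := h.prop.2.2 v hvT hγv
  -- Both `S` and `S'` avoid `r` and are crossed by `T` only in `e`, so they contain the same
  -- vertices of `T`.
  have := verts_subset_of_closed h.prop.2.1.connected (h.root_mem hr hγ)
    (X := {u | u ∈ S ↔ u ∈ S'}) (by simp [hrS, hrS']) (by
      intro a b hab ha
      have hab' : s(a, b) ∈ T.edgeSet := SimpleGraph.Subgraph.mem_edgeSet.2 hab
      have h1 := hS _ hab'
      have h2 := hS' _ (SimpleGraph.Subgraph.edgeSet_mono h.prop.1 hab')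
      rw [← h1, mk_mem_cut, mk_mem_cut] at h2
      simp only [Set.mem_ofPred_eq] at ha ⊢
      tauto) hvT'
  exact this.2 hvS'

/-- Bound on the cost of parity correction for the core of a tree. -/
lemma shortest_join_le_of_isCore {r : V} {c x : Sym2 V → ℝ} {y : V → ℝ} (hc : IsMetric c)
    (hxy : Feasible r x y) {δ : ℝ} (hδ : δ < 1) {T₀ T : Subgr V} {γ : ℝ}
    (hr : r ∈ T₀.verts) (hγ : γ ≤ y r) (hcore : IsCore y T₀ γ T)
    (hy1 : ∀ v, y v ≤ 1) (hyδ : ∀ v ∈ T₀.verts, δ ≤ y v)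
    {peak : Sym2 V → V} (hpeak : ∀ e ∈ T₀.edgeSet, IsPeak r y T₀ e (peak e))
    {J : Finset (Sym2 V)} (hJ : IsShortestJoin c (oddVerts (subEdges T)) J) :
    ∑ e ∈ J, c e ≤ 1 / (3 - δ) * cost c x +
      ∑ e ∈ subEdges T, c e * ((3 - δ - 2 * y (peak e)) / (3 - δ)) := by
  have h3 : 0 < 3 - δ := by linarith
  set z : Sym2 V → ℝ := fun e => 1 / (3 - δ) * x e +
    if e ∈ subEdges T then (3 - δ - 2 * y (peak e)) / (3 - δ) else 0 with hz
  have hlow : ∀ v, (1 - δ) / (3 - δ) ≤ (3 - δ - 2 * y v) / (3 - δ) := fun v => by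
    rw [div_le_div_iff_of_pos_right h3]
    linarith [hy1 v]
  have hlow0 : 0 ≤ (1 - δ) / (3 - δ) := div_nonneg (by linarith) h3.le
  have hcuts : ∀ S : Finset V, r ∉ S → Odd #(oddVerts (subEdges T) ∩ S) →
      1 ≤ ∑ e ∈ cut S, z e := by
    intro S hrS hodd
    rw [← odd_card_inter_cut (subEdges_subset_edges T)] at hodd
    have hsum : ∑ e ∈ cut S, z e = 1 / (3 - δ) * ∑ e ∈ cut S, x e +
        ∑ e ∈ subEdges T ∩ cut S, (3 - δ - 2 * y (peak e)) / (3 - δ) := by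
      rw [hz, sum_add_distrib, ← mul_sum, sum_ite_mem, inter_comm]
    rw [hsum]
    -- By parity the alternative is at least three crossings. The normalisation `3 - δ` makes the
    -- estimate come out as exactly 1 in both cases.
    by_cases h1 : #(subEdges T ∩ cut S) = 1
    · obtain ⟨e, he⟩ := card_eq_one.1 h1
      have heT : e ∈ T.edgeSet := by
        have : e ∈ subEdges T ∩ cut S := by rw [he]; exact mem_singleton_self e
        exact mem_subEdges.1 (mem_inter.1 this).1
      have heS : ∀ f ∈ T.edgeSet, f ∈ cut S ↔ f = e := fun f hf => by
        rw [← mem_singleton, ← he, mem_inter, mem_subEdges]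
        tauto
      have hp := hcore.peak_mem hr hγ heT (hpeak e
        (SimpleGraph.Subgraph.edgeSet_mono hcore.prop.1 heT)) hrS heS
      have hx := hxy.cuts S hrS _ hp
      rw [he, sum_singleton, one_div_mul_eq_div, ← add_div, le_div_iff₀ h3]
      linarith
    · have h3le : 3 ≤ #(subEdges T ∩ cut S) := by
        obtain ⟨k, hk⟩ := hodd
        omega
      obtain ⟨e, he⟩ := card_pos.1 (by omega : 0 < #(subEdges T ∩ cut S))
      rw [mem_inter, mem_subEdges] at he
      obtain ⟨v, hv, hvS⟩ := exists_mem_verts_of_mem_cut he.1 he.2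
      have hx := hxy.cuts S hrS v hvS
      have hyv := hyδ v (hcore.prop.1.1 hv)
      have hs : 3 * ((1 - δ) / (3 - δ)) ≤
          ∑ e ∈ subEdges T ∩ cut S, (3 - δ - 2 * y (peak e)) / (3 - δ) := by
        refine le_trans ?_ (card_nsmul_le_sum _ _ _ fun e _ => hlow (peak e))
        rw [nsmul_eq_mul]
        exact mul_le_mul_of_nonneg_right (by exact_mod_cast h3le) hlow0
      have hx' : 1 / (3 - δ) * (2 * δ) ≤ 1 / (3 - δ) * ∑ e ∈ cut S, x e :=
        mul_le_mul_of_nonneg_left (by linarith) (by positivity)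
      have heq : 1 / (3 - δ) * (2 * δ) + 3 * ((1 - δ) / (3 - δ)) = 1 := by
        field_simp
        ring
      linarith
  have hmain := hJ.le_of_covers_cuts hc.nonneg (z := z) ?_ ?_
  · refine hmain.trans (le_of_eq ?_)
    simp only [hz, mul_add, sum_add_distrib, cost, mul_sum, mul_ite, mul_zero]
    rw [sum_ite_mem, inter_eq_right.2 (subEdges_subset_edges T)]
    congr 1
    exact sum_congr rfl fun e _ => by ring
  · intro e he
    have h1 := hxy.nonneg_x e he
    have h2 : 0 ≤ if e ∈ subEdges T then (3 - δ - 2 * y (peak e)) / (3 - δ) else 0 := by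
      split_ifs
      · exact hlow0.trans (hlow _)
      · exact le_rfl
    simp only [hz]
    positivity
  · intro S hodd
    by_cases hrS : r ∈ S
    · rw [← cut_compl]
      refine hcuts Sᶜ (by simpa using hrS) ?_
      have hev := even_card_oddVerts (subEdges_subset_edges T)
      have hcard := card_inter_add_card_sdiff (oddVerts (subEdges T)) S
      rw [sdiff_eq_inter_compl] at hcard
      rw [← hcard] at hev
      rcases Nat.even_or_odd #(oddVerts (subEdges T) ∩ Sᶜ) with h | h
      · exact absurd hev (Nat.not_even_iff_odd.2 (hodd.add_even h))
      · exact h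
    · exact hcuts S hrS hodd

end Trees

/-! ### Shortcutting closed walks. -/

section Shortcut

variable {V : Type*} {c : Sym2 V → ℝ}

/-- Length of the walk that starts at `a`, visits the vertices of the list and ends at `b`. -/
def walkLength (c : Sym2 V → ℝ) : V → List V → V → ℝ
  | a, [], b => c s(a, b)
  | a, v :: l, b => c s(a, v) + walkLength c v l b

lemma cycleLength_cons (a : V) (l : List V) : cycleLength c (a :: l) = walkLength c a l a := by
  have key : ∀ (l : List V) (b d : V),
      (List.zipWith (fun u v => c s(u, v)) (b :: l) (l ++ [d])).sum = walkLength c b l d := by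
    intro l
    induction l with
    | nil => intro b d; simp [walkLength]
    | cons v l ih => intro b d; simpa [walkLength] using ih v d
  simpa [cycleLength] using key l a a

lemma le_walkLength (hc : IsMetric c) (a b : V) (l : List V) :
    c s(a, b) ≤ walkLength c a l b := by
  induction l generalizing a with
  | nil => simp [walkLength]
  | cons u l ih =>
    simp only [walkLength]
    linarith [hc.triangle a u b, ih u]

lemma walkLength_change_start (hc : IsMetric c) (a v b : V) (l : List V) :
    walkLength c a l b ≤ c s(a, v) + walkLength c v l b := by
  cases l with
  | nil => exact hc.triangle a v b
  | cons u l =>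
    simp only [walkLength]
    linarith [hc.triangle a v u]

lemma walkLength_change_end (hc : IsMetric c) (a v b : V) (l : List V) :
    walkLength c a l b ≤ walkLength c a l v + c s(v, b) := by
  induction l generalizing a with
  | nil => exact hc.triangle a v b
  | cons u l ih =>
    simp only [walkLength]
    linarith [ih u]

lemma walkLength_sublist (hc : IsMetric c) {l l' : List V} (h : l'.Sublist l) (a b : V) :
    walkLength c a l' b ≤ walkLength c a l b := by
  induction h generalizing a with
  | slnil => exact le_rfl
  | cons v _ ih =>
    simp only [walkLength]
    exact (walkLength_change_start hc a v b _).trans (by linarith [ih v])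
  | cons_cons v _ ih =>
    simp only [walkLength]
    linarith [ih v]

lemma cycleLength_nonneg (hc : IsMetric c) (C : List V) : 0 ≤ cycleLength c C := by
  cases C with
  | nil => simp [cycleLength]
  | cons a l =>
    rw [cycleLength_cons]
    exact (hc.nonneg _).trans (le_walkLength hc a a l)

/-- Shortcutting does not increase the length of a cycle. -/
lemma cycleLength_sublist (hc : IsMetric c) {l l' : List V} (h : l'.Sublist l) :
    cycleLength c l' ≤ cycleLength c l := by
  induction h with
  | slnil => exact le_rfl
  | cons_cons v h _ =>
    rw [cycleLength_cons, cycleLength_cons]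
    exact walkLength_sublist hc h v v
  | @cons l₁ l₂ a h ih =>
    refine ih.trans ?_
    -- The first vertex `a` is dropped, so the base point of the cycle changes to `b`; the detour
    -- through `a` is then an inner part of the closing step.
    cases l₂ with
    | nil => simpa [cycleLength] using hc.nonneg _
    | cons b l =>
      rw [cycleLength_cons, cycleLength_cons]
      simp only [walkLength]
      have := walkLength_change_end hc b a b l
      linarith

/-- The support lists `u` at both ends, so the closing step goes from `u` to itself and is free. -/
lemma cycleLength_support (hc : IsMetric c) {u : V} (w : (⊤ : SimpleGraph V).Walk u u) :
    cycleLength c w.support = (w.edges.map c).sum := by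
  have key : ∀ {a b : V} (w : (⊤ : SimpleGraph V).Walk a b),
      walkLength c a w.support.tail b = (w.edges.map c).sum := by
    intro a b w
    induction w with
    | nil => simp [walkLength, hc.self]
    | cons h p ih =>
      rw [SimpleGraph.Walk.support_cons, List.tail_cons, ← SimpleGraph.Walk.cons_tail_support]
      simp only [walkLength, SimpleGraph.Walk.edges_cons, List.map_cons, List.sum_cons, ih]
  rw [← SimpleGraph.Walk.cons_tail_support, cycleLength_cons, key]

variable [Fintype V] [DecidableEq V]

lemma cycleLength_le_of_isCorrectedCycle (hc : IsMetric c) {T : Subgr V} {C : List V}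
    (h : IsCorrectedCycle c T C) : ∃ J, IsShortestJoin c (oddVerts (subEdges T)) J ∧
      cycleLength c C ≤ ∑ e ∈ subEdges T, c e + ∑ e ∈ J, c e := by
  obtain ⟨J, u, w, hJ, hw, -, hC, -, -⟩ := h
  refine ⟨J, hJ, (cycleLength_sublist hc hC).trans (le_of_eq ?_)⟩
  rw [cycleLength_support hc]
  have := congrArg (fun m => (Multiset.map c m).sum) hw
  simpa using this

end Shortcut

/-! ### Effect of splitting on cost and vertex values. -/

section Splitting

variable {V : Type*} [Fintype V] [DecidableEq V] {r : V} {c : Sym2 V → ℝ}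

lemma cost_single (hc : IsMetric c) (e : Sym2 V) (ε : ℝ) : cost c (Pi.single e ε) = c e * ε := by
  unfold cost
  by_cases he : e ∈ edges V
  · rw [sum_eq_single_of_mem e he fun f _ hf => by rw [Pi.single_eq_of_ne hf, mul_zero],
      Pi.single_eq_same]
  · rw [sum_eq_zero fun f hf => by
      rw [Pi.single_eq_of_ne (by rintro rfl; exact he hf), mul_zero]]
    induction e with | _ u v =>
    have : u = v := by simpa [edges] using he
    rw [this, hc.self, zero_mul]

lemma cost_add (x x' : Sym2 V → ℝ) : cost c (x + x') = cost c x + cost c x' := by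
  simp [cost, mul_add, sum_add_distrib]

lemma cost_sub (x x' : Sym2 V → ℝ) : cost c (x - x') = cost c x - cost c x' := by
  simp [cost, mul_sub, sum_sub_distrib]

lemma FeasibleSplitting.cost_le (hc : IsMetric c) {v : V} {p q : (Sym2 V → ℝ) × (V → ℝ)}
    (h : FeasibleSplitting r v p q) : cost c q.1 ≤ cost c p.1 := by
  obtain ⟨s, t, ε, -, -, hε, hx, -, -⟩ := h
  rw [hx, cost_add, cost_sub, cost_sub, cost_single hc, cost_single hc, cost_single hc]
  have h1 := mul_le_mul_of_nonneg_right (hc.triangle s v t) hε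
  rw [Sym2.eq_swap (a := s) (b := v)] at h1
  linarith

lemma CompleteSplitting.spec (hc : IsMetric c) {v : V} {p q : (Sym2 V → ℝ) × (V → ℝ)}
    (h : CompleteSplitting r v p q) (hp : Feasible r p.1 p.2) :
    Feasible r q.1 q.2 ∧ cost c q.1 ≤ cost c p.1 ∧ q.2 v = 0 ∧ ∀ u ≠ v, q.2 u = p.2 u := by
  obtain ⟨h, hv⟩ := h
  suffices H : Feasible r q.1 q.2 ∧ cost c q.1 ≤ cost c p.1 ∧ ∀ u ≠ v, q.2 u = p.2 u from
    ⟨H.1, H.2.1, hv, H.2.2⟩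
  clear hv
  induction h with
  | refl => exact ⟨hp, le_rfl, fun _ _ => rfl⟩
  | tail _ hs ih =>
    refine ⟨?_, (hs.cost_le hc).trans ih.2.1, fun u hu => ?_⟩
    · obtain ⟨_, _, _, _, _, _, _, _, hf⟩ := hs
      exact hf
    · obtain ⟨_, _, _, _, _, _, _, hy, _⟩ := hs
      rw [hy, Pi.sub_apply, Pi.single_eq_of_ne hu, sub_zero, ih.2.2 u hu]

/-- Splitting at one vertex leaves the other values alone, so a value that has reached zero stays
zero. -/
lemma CompleteSplittings.spec (hc : IsMetric c) {l : List V} {p q : (Sym2 V → ℝ) × (V → ℝ)}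
    (h : CompleteSplittings r l p q) (hp : Feasible r p.1 p.2) :
    Feasible r q.1 q.2 ∧ cost c q.1 ≤ cost c p.1 ∧
      ∀ u, (u ∉ l ∧ q.2 u = p.2 u) ∨ q.2 u = 0 := by
  induction h with
  | nil => exact ⟨hp, le_rfl, fun u => Or.inl ⟨by simp, rfl⟩⟩
  | @cons v l p q q' hs _ ih =>
    obtain ⟨hf, hcost, hv, hu⟩ := hs.spec hc hp
    obtain ⟨hf', hcost', hu'⟩ := ih hf
    refine ⟨hf', hcost'.trans hcost, fun u => ?_⟩
    by_cases huv : u = v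
    · subst huv
      rcases hu' u with h | h
      · exact Or.inr (h.2.trans hv)
      · exact Or.inr h
    · rw [← hu u huv]
      rcases hu' u with h | h
      · exact Or.inl ⟨by simp [huv, h.1], h.2⟩
      · exact Or.inr h

lemma ObtainedBySplitting.spec (hc : IsMetric c) {δ : ℝ} {xs x : Sym2 V → ℝ} {ys y : V → ℝ}
    (h : ObtainedBySplitting r δ xs ys x y) (hs : Feasible r xs ys) :
    Feasible r x y ∧ cost c x ≤ cost c xs ∧ ∀ v, y v = 0 ∨ δ ≤ y v := by
  obtain ⟨l, -, hl, h⟩ := h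
  obtain ⟨hf, hcost, hu⟩ := h.spec hc hs
  refine ⟨hf, hcost, fun v => ?_⟩
  rcases hu v with h | h
  · exact Or.inr ((not_lt.1 fun hlt => h.1 ((hl v).2 hlt)).trans_eq h.2.symm)
  · exact Or.inl h

end Splitting

/-! ### Averages over the tree decomposition. -/

section Expectation

variable {V : Type*} [Fintype V] [DecidableEq V] {r : V} {x : Sym2 V → ℝ} {y : V → ℝ}
  {𝒯 : Finset (Subgr V)} {μ : Subgr V → ℝ}

lemma IsTreeDecomposition.y_le_one (h : IsTreeDecomposition r x y 𝒯 μ) (v : V) : y v ≤ 1 := by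
  classical
  rw [← h.vert_eq v, ← h.sum_eq_one]
  exact sum_le_sum_of_subset_of_nonneg (filter_subset _ _) fun T hT _ => (h.mem_Icc T hT).1

lemma IsTreeDecomposition.le_y (h : IsTreeDecomposition r x y 𝒯 μ) {T : Subgr V} (hT : T ∈ 𝒯)
    {v : V} (hv : v ∈ T.verts) : μ T ≤ y v := by
  classical
  rw [← h.vert_eq v]
  exact single_le_sum (f := μ) (fun T hT => (h.mem_Icc T (mem_filter.1 hT).1).1)
    (mem_filter.2 ⟨hT, hv⟩)

lemma IsTreeDecomposition.sum_cost_le (h : IsTreeDecomposition r x y 𝒯 μ) {c : Sym2 V → ℝ}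
    (hc : IsMetric c) : ∑ T ∈ 𝒯, ∑ e ∈ subEdges T, μ T * c e ≤ cost c x := by
  classical
  have h1 : ∀ T ∈ 𝒯, ∑ e ∈ subEdges T, μ T * c e =
      ∑ e ∈ edges V, if e ∈ T.edgeSet then μ T * c e else 0 := by
    intro T _
    rw [← sum_filter]
    refine sum_congr ?_ fun _ _ => rfl
    ext e
    rw [mem_filter, mem_subEdges]
    exact ⟨fun he => ⟨subEdges_subset_edges T (mem_subEdges.2 he), he⟩, fun he => he.2⟩
  rw [sum_congr rfl h1, sum_comm]
  refine sum_le_sum fun e he => ?_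
  rw [← sum_filter, ← sum_mul, mul_comm]
  exact mul_le_mul_of_nonneg_left (h.edge_le e he) (hc.nonneg e)

/-- The weights sum to 1, leaving no mass elsewhere. Positivity matters because it forces positive
`y`-values on the tree, and positive values are at least `δ` after splitting. -/
lemma IsTreeDecomposition.ae_mem (h : IsTreeDecomposition r x y 𝒯 μ) {Ω : Type*}
    [MeasurableSpace Ω] {P : Measure Ω} [IsProbabilityMeasure P] {T₀ : Ω → Subgr V}
    (hT₀ : Measurable T₀) (hlaw : ∀ T ∈ 𝒯, P.real {ω | T₀ ω = T} = μ T) :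
    ∀ᵐ ω ∂P, T₀ ω ∈ 𝒯 ∧ 0 < μ (T₀ ω) := by
  classical
  have hmeas : ∀ T, MeasurableSet {ω | T₀ ω = T} := fun T =>
    hT₀ (show MeasurableSet ({T} : Set (Subgr V)) from trivial)
  have hsum : P.real (⋃ T ∈ 𝒯.filter fun T => 0 < μ T, {ω | T₀ ω = T}) = 1 := by
    rw [measureReal_biUnion_finset ?_ fun T _ => hmeas T]
    · rw [sum_congr rfl fun T hT => hlaw T (mem_filter.1 hT).1, ← h.sum_eq_one]
      refine sum_filter_of_ne fun T hT hne => ?_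
      exact lt_of_le_of_ne (h.mem_Icc T hT).1 hne.symm
    · intro T _ T' _ hne
      refine Set.disjoint_left.2 fun ω h1 h2 => hne ?_
      exact Eq.trans (Eq.symm h1) h2
  have hms : MeasurableSet (⋃ T ∈ 𝒯.filter fun T => 0 < μ T, {ω | T₀ ω = T}) :=
    Finset.measurableSet_biUnion _ fun T _ => hmeas T
  have hae := (prob_compl_eq_zero_iff hms).2
    (by rw [measureReal_def] at hsum; exact (ENNReal.toReal_eq_one_iff _).1 hsum)
  filter_upwards [mem_ae_iff.2 hae] with ω hω
  simp only [Set.mem_iUnion, mem_filter] at hω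
  obtain ⟨T, hT, rfl⟩ := hω
  exact hT

/-- The factor by which an edge with peak value `t` is paid, multiplied with the probability that it
belongs to the core. -/
lemma core_prob_mul_le {δ κ t p : ℝ} (hδ₁ : δ < 1)
    (hδt : δ ≤ t) (ht1 : t ≤ 1) (hp1 : p ≤ 1)
    (hp : t ∈ Set.Icc δ κ → p = (3 - δ - κ) / (3 - δ - t)) :
    p * (2 * (3 - δ - t) / (3 - δ)) ≤ 2 * (3 - δ - κ) / (3 - δ) := by
  have h3 : 0 < 3 - δ := by linarith
  have ht : 0 < 3 - δ - t := by linarith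
  rcases le_or_gt t κ with h | h
  · rw [hp ⟨hδt, h⟩]
    refine le_of_eq ?_
    field_simp
  · calc p * (2 * (3 - δ - t) / (3 - δ)) ≤ 1 * (2 * (3 - δ - t) / (3 - δ)) := by gcongr
      _ ≤ 2 * (3 - δ - κ) / (3 - δ) := by
        rw [one_mul, div_le_div_iff_of_pos_right h3]
        linarith

end Expectation

end PCTSP

/-! ### The expected length of the cycle. -/

open Finset MeasureTheory in
theorem lemma4 {V : Type*} [Fintype V] [DecidableEq V] (r : V)
    (c : Sym2 V → ℝ) (hc : PCTSP.IsMetric c)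
    (δ κ : ℝ) (hδ₀ : 0 ≤ δ) (hδ₁ : δ < 1) (hδκ : δ ≤ κ) (hκ₁ : κ ≤ 1)
    -- the initial solution of the relaxation and the one obtained from it by splitting off
    (xs : Sym2 V → ℝ) (ys : V → ℝ) (hs : PCTSP.Feasible r xs ys)
    (x : Sym2 V → ℝ) (y : V → ℝ) (hxy : PCTSP.ObtainedBySplitting r δ xs ys x y)
    -- the tree decomposition of the latter
    (𝒯 : Finset (PCTSP.Subgr V)) (μ : PCTSP.Subgr V → ℝ)
    (hμ : PCTSP.IsTreeDecomposition r x y 𝒯 μ)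
    -- the random tree and the independent random threshold
    {Ω : Type*} [MeasurableSpace Ω] (P : MeasureTheory.Measure Ω)
    [MeasureTheory.IsProbabilityMeasure P]
    (T₀ : Ω → PCTSP.Subgr V) (hT₀ : Measurable T₀)
    (hT₀_law : ∀ T ∈ 𝒯, P.real {ω | T₀ ω = T} = μ T)
    (γ : Ω → ℝ) (hγ : Measurable γ)
    (hγ_mem : ∀ᵐ ω ∂P, γ ω ∈ Set.Icc δ κ)
    (hγ_cdf : ∀ t ∈ Set.Icc δ κ, P.real {ω | γ ω ≤ t} = (3 - δ - κ) / (3 - δ - t))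
    (hind : ProbabilityTheory.IndepFun T₀ γ P)
    -- the core and the cycle constructed from it
    (T : Ω → PCTSP.Subgr V) (hT : ∀ᵐ ω ∂P, PCTSP.IsCore y (T₀ ω) (γ ω) (T ω))
    (C : Ω → List V) (hC : ∀ᵐ ω ∂P, PCTSP.IsCorrectedCycle c (T ω) (C ω))
    (hC_meas : AEMeasurable (fun ω => PCTSP.cycleLength c (C ω)) P) :
    MeasureTheory.Integrable (fun ω => PCTSP.cycleLength c (C ω)) P ∧
      ∫ ω, PCTSP.cycleLength c (C ω) ∂P ≤
        (7 - 2 * δ - 2 * κ) / (3 - δ) * PCTSP.cost c xs := by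
  classical
  have h3 : 0 < 3 - δ := by linarith
  obtain ⟨hf, hcost, hy⟩ := hxy.spec hc hs
  have hy1 := hμ.y_le_one
  have hyδ : ∀ S ∈ 𝒯, 0 < μ S → ∀ v ∈ S.verts, δ ≤ y v := by
    intro S hS hpos v hv
    rcases hy v with h | h
    · have := hμ.le_y hS hv
      linarith
    · exact h
  have hpk : ∀ (S : PCTSP.Subgr V) (e : Sym2 V), ∃ v,
      S ∈ 𝒯 → e ∈ S.edgeSet → PCTSP.IsPeak r y S e v := by
    intro S e
    by_cases h : S ∈ 𝒯 ∧ e ∈ S.edgeSet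
    · obtain ⟨v, hv⟩ := PCTSP.exists_isPeak (hμ.isTree S h.1) r y h.2
      exact ⟨v, fun _ _ => hv⟩
    · exact ⟨r, fun h1 h2 => absurd ⟨h1, h2⟩ h⟩
  choose peak hpeak using hpk
  set K : PCTSP.Subgr V → Sym2 V → ℝ :=
    fun S e => c e * (2 * (3 - δ - y (peak S e)) / (3 - δ)) with hK
  have hK0 : ∀ S e, 0 ≤ K S e := fun S e =>
    mul_nonneg (hc.nonneg e) (div_nonneg (by linarith [hy1 (peak S e)]) h3.le)
  -- Peaks depend only on the sampled tree, so independence factors this event. It replaces "`e`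
  -- lies in the core", whose measurability is not assumed.
  set A : PCTSP.Subgr V → Sym2 V → Set Ω := fun S e => T₀ ⁻¹' {S} ∩ γ ⁻¹' Set.Iic (y (peak S e))
    with hA
  have hAm : ∀ S e, MeasurableSet (A S e) := fun S e =>
    (hT₀ (show MeasurableSet ({S} : Set (PCTSP.Subgr V)) from trivial)).inter (hγ measurableSet_Iic)
  set g : Ω → ℝ := fun ω => 1 / (3 - δ) * PCTSP.cost c x +
    ∑ S ∈ 𝒯, ∑ e ∈ PCTSP.subEdges S, (A S e).indicator (fun _ => K S e) ω with hg
  have hind_int : ∀ S e, Integrable ((A S e).indicator fun _ => K S e) P := fun S e =>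
    (integrable_const _).indicator (hAm S e)
  have hg_sum_int : Integrable (fun ω => ∑ S ∈ 𝒯, ∑ e ∈ PCTSP.subEdges S,
      (A S e).indicator (fun _ => K S e) ω) P :=
    integrable_finsetSum _ fun S _ => integrable_finsetSum _ fun e _ => hind_int S e
  have hg_int : Integrable g P := (integrable_const _).add hg_sum_int
  have hbound : ∀ᵐ ω ∂P, PCTSP.cycleLength c (C ω) ≤ g ω := by
    filter_upwards [hμ.ae_mem hT₀ hT₀_law, hγ_mem, hT, hC] with ω hω hγω hTω hCω
    obtain ⟨J, hJ, hlen⟩ := PCTSP.cycleLength_le_of_isCorrectedCycle hc hCω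
    have hr := hμ.root_mem _ hω.1
    have hγr : γ ω ≤ y r := by rw [hf.root]; exact hγω.2.trans hκ₁
    have hJle := PCTSP.shortest_join_le_of_isCore hc hf hδ₁ hr hγr hTω hy1
      (hyδ _ hω.1 hω.2) (fun e he => hpeak (T₀ ω) e hω.1 he) hJ
    have hsum : ∑ e ∈ PCTSP.subEdges (T ω), c e + ∑ e ∈ PCTSP.subEdges (T ω),
        c e * ((3 - δ - 2 * y (peak (T₀ ω) e)) / (3 - δ)) =
        ∑ e ∈ PCTSP.subEdges (T ω), K (T₀ ω) e := by
      rw [← sum_add_distrib]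
      refine sum_congr rfl fun e _ => ?_
      simp only [hK]
      field_simp
      ring
    have hsub : PCTSP.subEdges (T ω) ⊆ PCTSP.subEdges (T₀ ω) := fun e he =>
      PCTSP.mem_subEdges.2 (SimpleGraph.Subgraph.edgeSet_mono hTω.prop.1 (PCTSP.mem_subEdges.1 he))
    have hle1 : ∑ e ∈ PCTSP.subEdges (T ω), K (T₀ ω) e ≤
        ∑ e ∈ PCTSP.subEdges (T₀ ω), (A (T₀ ω) e).indicator (fun _ => K (T₀ ω) e) ω := by
      refine le_trans (le_of_eq (sum_congr rfl fun e he => ?_))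
        (sum_le_sum_of_subset_of_nonneg hsub fun e _ _ =>
          Set.indicator_nonneg (fun _ _ => hK0 _ _) _)
      have heT := PCTSP.mem_subEdges.1 he
      have heT₀ := PCTSP.mem_subEdges.1 (hsub he)
      rw [Set.indicator_of_mem]
      exact ⟨rfl, hTω.le_peak hr hγr heT (hpeak _ e hω.1 heT₀)⟩
    have hle2 : ∑ e ∈ PCTSP.subEdges (T₀ ω), (A (T₀ ω) e).indicator (fun _ => K (T₀ ω) e) ω ≤
        ∑ S ∈ 𝒯, ∑ e ∈ PCTSP.subEdges S, (A S e).indicator (fun _ => K S e) ω :=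
      single_le_sum (f := fun S => ∑ e ∈ PCTSP.subEdges S, (A S e).indicator (fun _ => K S e) ω)
        (fun S _ => sum_nonneg fun e _ => Set.indicator_nonneg (fun _ _ => hK0 _ _) _) hω.1
    simp only [hg]
    linarith
  have hint : Integrable (fun ω => PCTSP.cycleLength c (C ω)) P := by
    refine hg_int.mono' hC_meas.aestronglyMeasurable ?_
    filter_upwards [hbound] with ω hω
    rwa [Real.norm_of_nonneg (PCTSP.cycleLength_nonneg hc _)]
  refine ⟨hint, (integral_mono_ae hint hg_int hbound).trans ?_⟩
  have hgval : ∫ ω, g ω ∂P = 1 / (3 - δ) * PCTSP.cost c x +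
      ∑ S ∈ 𝒯, ∑ e ∈ PCTSP.subEdges S, P.real (A S e) * K S e := by
    simp only [hg]
    rw [integral_add (integrable_const _) hg_sum_int, integral_const, probReal_univ, one_smul,
      integral_finsetSum _ fun S _ => integrable_finsetSum _ fun e _ => hind_int S e]
    congr 1
    refine sum_congr rfl fun S _ => ?_
    rw [integral_finsetSum _ fun e _ => hind_int S e]
    exact sum_congr rfl fun e _ => by rw [integral_indicator_const _ (hAm S e), smul_eq_mul]
  have hterm : ∀ S ∈ 𝒯, ∀ e ∈ PCTSP.subEdges S,
      P.real (A S e) * K S e ≤ 2 * (3 - δ - κ) / (3 - δ) * (μ S * c e) := by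
    intro S hS e he
    have hprod : P.real (A S e) = μ S * P.real {ω | γ ω ≤ y (peak S e)} := by
      rw [← hT₀_law S hS]
      simp only [hA, measureReal_def]
      rw [hind.measure_inter_preimage_eq_mul _ _ trivial measurableSet_Iic, ENNReal.toReal_mul]
      rfl
    have hμ0 := (hμ.mem_Icc S hS).1
    rw [hprod]
    rcases hμ0.eq_or_lt with h0 | hpos
    · simp [← h0]
    · have hv := (hpeak S e hS (PCTSP.mem_subEdges.1 he)).1
      have := PCTSP.core_prob_mul_le hδ₁ (hyδ S hS hpos _ hv) (hy1 _)
        measureReal_le_one (hγ_cdf (y (peak S e)))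
      have h2 := mul_le_mul_of_nonneg_left this (mul_nonneg hμ0 (hc.nonneg e))
      simp only [hK]
      linarith
  have hcoef : 0 ≤ 2 * (3 - δ - κ) / (3 - δ) := div_nonneg (by linarith) h3.le
  rw [hgval]
  calc 1 / (3 - δ) * PCTSP.cost c x + ∑ S ∈ 𝒯, ∑ e ∈ PCTSP.subEdges S, P.real (A S e) * K S e
      ≤ 1 / (3 - δ) * PCTSP.cost c x +
        2 * (3 - δ - κ) / (3 - δ) * ∑ S ∈ 𝒯, ∑ e ∈ PCTSP.subEdges S, μ S * c e := by
        rw [mul_sum]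
        refine add_le_add le_rfl (sum_le_sum fun S hS => ?_)
        rw [mul_sum]
        exact sum_le_sum (hterm S hS)
    _ ≤ 1 / (3 - δ) * PCTSP.cost c x + 2 * (3 - δ - κ) / (3 - δ) * PCTSP.cost c x :=
        add_le_add le_rfl (mul_le_mul_of_nonneg_left (hμ.sum_cost_le hc) hcoef)
    _ = (7 - 2 * δ - 2 * κ) / (3 - δ) * PCTSP.cost c x := by
        field_simp
        ring
    _ ≤ (7 - 2 * δ - 2 * κ) / (3 - δ) * PCTSP.cost c xs :=
        mul_le_mul_of_nonneg_left hcost (div_nonneg (by linarith) h3.le)
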